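/- Let $(X,d)$ be a metric space with a basepoint $e\in X$. A scaling factor is a sequence $\alpha=(\alpha_n)_{n\in\mathbb N}$ of positive real numbers with $\alpha_n\to+\infty$. Given a non-principal ultrafilter $\mu$ on $\mathbb N$, the asymptotic cone $\mathrm{Cone}_\mu(X,e,\alpha)$ is the set of sequences $(x_n)$ in $X$ with $\mu\text{-}\lim d(x_n,e)/\alpha_n<\infty$, modulo the relation $(x_n)\approx(y_n)\iff \mu\text{-}\lim d(x_n,y_n)/\alpha_n=0$, with the metric $d_\infty([x_n],[y_n])=\mu\text{-}\lim d(x_n,y_n)/\alpha_n$. The iterated cones are defined by $\mathrm{Cone}^0_\mu(X,e,\alpha)=X$, $e(0)=e$, and, for $i\ge 0$, $\mathrm{Cone}^{i+1}_\mu(X,e,\alpha)=\mathrm{Cone}_\mu\big(\mathrm{Cone}^i_\mu(X,e,\alpha),e(i),\alpha\big)$, where $e(i+1)$ is the class of the constant sequence with value $e(i)$. **Theorem.** For every positive integer $m$ there exist a metric space $X$ with a basepoint $e$ and a scaling factor $\alpha$ such that, for every non-principal ultrafilter $\mu$ on $\mathbb N$ and all natural numbers $i,j\ge 0$, the spaces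 $\mathrm{Cone}^i_\mu(X,e,\alpha)$ and $\mathrm{Cone}^j_\mu(X,e,\alpha)$ are homeomorphic if and only if $i\equiv j \pmod m$. -/

import Mathlib

open Filter Topology
open scoped ENNReal

noncomputable section

namespace IterCone

universe u

/-- The limit along the ultrafilter `μ` of a sequence with values in the compact Hausdorff
space `[0, ∞]`. -/
def ulim (μ : Ultrafilter ℕ) (f : ℕ → ℝ≥0∞) : ℝ≥0∞ := (μ.map f).lim

theorem tendsto_ulim (μ : Ultrafilter ℕ) (f : ℕ → ℝ≥0∞) :
    Tendsto f (μ : Filter ℕ) (𝓝 (ulim μ f)) :=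
  (μ.map f).le_nhds_lim

theorem ulim_eq {μ : Ultrafilter ℕ} {f : ℕ → ℝ≥0∞} {a : ℝ≥0∞}
    (h : Tendsto f (μ : Filter ℕ) (𝓝 a)) : ulim μ f = a :=
  tendsto_nhds_unique (tendsto_ulim μ f) h

/-- The limit along `μ` of `d(x_n, y_n) / α_n`, as an element of `[0, ∞]`. -/
def scaledDist {X : Type u} [MetricSpace X] (μ : Ultrafilter ℕ) (α : ℕ → ℝ) (x y : ℕ → X) :
    ℝ≥0∞ :=
  ulim μ (fun n => ENNReal.ofReal (dist (x n) (y n) / α n))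

theorem scaledDist_self {X : Type u} [MetricSpace X] (μ : Ultrafilter ℕ) (α : ℕ → ℝ)
    (x : ℕ → X) : scaledDist μ α x x = 0 :=
  ulim_eq (by simp)

theorem scaledDist_comm {X : Type u} [MetricSpace X] (μ : Ultrafilter ℕ) (α : ℕ → ℝ)
    (x y : ℕ → X) : scaledDist μ α x y = scaledDist μ α y x := by
  simp only [scaledDist, dist_comm]

theorem scaledDist_triangle {X : Type u} [MetricSpace X] (μ : Ultrafilter ℕ) (α : ℕ → ℝ)
    (x y z : ℕ → X) : scaledDist μ α x z ≤ scaledDist μ α x y + scaledDist μ α y z := by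
  refine le_of_tendsto_of_tendsto' (tendsto_ulim μ _)
    ((tendsto_ulim μ _).add (tendsto_ulim μ _)) fun n => ?_
  rcases le_total (α n) 0 with h | h
  · rw [ENNReal.ofReal_of_nonpos (div_nonpos_of_nonneg_of_nonpos dist_nonneg h)]
    exact zero_le
  · rw [← ENNReal.ofReal_add (div_nonneg dist_nonneg h) (div_nonneg dist_nonneg h), ← add_div]
    exact ENNReal.ofReal_le_ofReal (div_le_div_of_nonneg_right (dist_triangle _ _ _) h)

/-- The sequences `(x_n)` in `X` with `μ-lim d(x_n, e_n) / α_n < ∞`. -/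
structure ConeSeq (X : Type u) [MetricSpace X] (μ : Ultrafilter ℕ) (e : ℕ → X) (α : ℕ → ℝ) :
    Type u where
  seq : ℕ → X
  finite : scaledDist μ α seq e < ⊤

theorem ConeSeq.scaledDist_ne_top {X : Type u} [MetricSpace X] {μ : Ultrafilter ℕ} {e : ℕ → X}
    {α : ℕ → ℝ} (x y : ConeSeq X μ e α) : scaledDist μ α x.seq y.seq ≠ ⊤ := by
  refine ne_top_of_le_ne_top ?_ (scaledDist_triangle μ α x.seq e y.seq)
  rw [scaledDist_comm μ α e]
  exact ENNReal.add_ne_top.2 ⟨x.finite.ne, y.finite.ne⟩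

instance {X : Type u} [MetricSpace X] {μ : Ultrafilter ℕ} {e : ℕ → X} {α : ℕ → ℝ} :
    PseudoMetricSpace (ConeSeq X μ e α) where
  dist x y := (scaledDist μ α x.seq y.seq).toReal
  dist_self x := by simp [scaledDist_self]
  dist_comm x y := by simp only [scaledDist_comm μ α x.seq]
  dist_triangle x y z := by
    rw [← ENNReal.toReal_add (x.scaledDist_ne_top y) (y.scaledDist_ne_top z)]
    exact ENNReal.toReal_mono
      (ENNReal.add_ne_top.2 ⟨x.scaledDist_ne_top y, y.scaledDist_ne_top z⟩)
      (scaledDist_triangle μ α _ _ _)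

/-- The asymptotic cone `Cone_μ(X, e, α)`: the quotient of `ConeSeq X μ e α` that identifies
sequences at distance `0`, with the induced metric (see `cone_mk_eq_mk` and `cone_dist_mk`). -/
abbrev Cone (X : Type u) [MetricSpace X] (μ : Ultrafilter ℕ) (e : ℕ → X) (α : ℕ → ℝ) : Type u :=
  SeparationQuotient (ConeSeq X μ e α)

theorem cone_dist_mk {X : Type u} [MetricSpace X] {μ : Ultrafilter ℕ} {e : ℕ → X} {α : ℕ → ℝ}
    (x y : ConeSeq X μ e α) :
    dist (SeparationQuotient.mk x : Cone X μ e α) (SeparationQuotient.mk y) =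
      (scaledDist μ α x.seq y.seq).toReal := rfl

theorem cone_mk_eq_mk {X : Type u} [MetricSpace X] {μ : Ultrafilter ℕ} {e : ℕ → X} {α : ℕ → ℝ}
    (x y : ConeSeq X μ e α) :
    (SeparationQuotient.mk x : Cone X μ e α) = SeparationQuotient.mk y ↔
      scaledDist μ α x.seq y.seq = 0 := by
  rw [← dist_eq_zero, cone_dist_mk, ENNReal.toReal_eq_zero_iff]
  simp [x.scaledDist_ne_top y]

/-- A metric space with a base-point. -/
structure PointedMetricSpace : Type (u + 1) where
  carrier : Type u
  [metric : MetricSpace carrier]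
  point : carrier

attribute [instance] PointedMetricSpace.metric

/-- The asymptotic cone of `P` at the constant sequence of its base-point, pointed by the class
of that constant sequence. -/
def PointedMetricSpace.cone (P : PointedMetricSpace.{u}) (μ : Ultrafilter ℕ) (α : ℕ → ℝ) :
    PointedMetricSpace.{u} where
  carrier := Cone P.carrier μ (fun _ => P.point) α
  point := SeparationQuotient.mk
    ⟨fun _ => P.point, by rw [scaledDist_self]; exact ENNReal.zero_lt_top⟩

/-- The `i`-th iterated asymptotic cone `Cone^i_μ(X, e, α)` of `P = (X, e)`, with its
base-point; `Cone^0` is `P` itself. -/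
def iterCone (P : PointedMetricSpace.{u}) (μ : Ultrafilter ℕ) (α : ℕ → ℝ) :
    ℕ → PointedMetricSpace.{u}
  | 0 => P
  | i + 1 => (iterCone P μ α i).cone μ α

/-- A scaling factor: a sequence of positive real numbers that diverges to `+∞`. -/
def IsScalingFactor (α : ℕ → ℝ) : Prop :=
  (∀ n, 0 < α n) ∧ Tendsto α atTop atTop

/-- An ultrafilter is non-principal if it is not `{A | n ∈ A}` for any `n`. -/
def NonPrincipal (μ : Ultrafilter ℕ) : Prop :=
  ∀ n : ℕ, μ ≠ pure n

end IterCone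

end

namespace IterCone

/-! The spaces are closed sets `model m i` in `[0, ∞)`, built so that `model m i`, seen at scale
`scale m n`, shows the finite set `stage m n (i + 1)`. These sets increase to a dense subset of
`model m (i + 1)`, and huge gaps push everything else to 0 or to infinity (`model_trichotomy`).
Hence the cone of `model m i` is `model m (i + 1)`, whatever the ultrafilter (`isRadial_iterCone`).

The index `i` enters only through the nodes, which depend on `i % m`, so the models are periodic.
The nodes accumulate at exactly `i % m + 1` points, and the scaled copies add none, being finite and
escaping to infinity (`derivedSet_model`). The number of non-isolated points is a homeomorphism
invariant and recovers `i % m`. -/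

/-! ### Cones of subsets of the half-line -/

/-- `P` is isometric, through the distance to its base-point, to the subset `S` of `[0, ∞)`. -/
def PointedMetricSpace.IsRadial (P : PointedMetricSpace) (S : Set ℝ) : Prop :=
  (∀ x y : P.carrier, dist x y = |dist x P.point - dist y P.point|) ∧
    Set.range (fun x : P.carrier => dist x P.point) = S

theorem PointedMetricSpace.IsRadial.nonempty_homeomorph {P : PointedMetricSpace} {S : Set ℝ}
    (h : P.IsRadial S) : Nonempty (P.carrier ≃ₜ S) := by
  have hi : Isometry (fun x : P.carrier => dist x P.point) :=
    Isometry.of_dist_eq fun x y => by rw [Real.dist_eq, h.1 x y]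
  exact ⟨hi.isometryEquivOnRange.toHomeomorph.trans (Homeomorph.setCongr h.2)⟩

theorem isRadial_subtype {S : Set ℝ} (h0 : (0 : ℝ) ∈ S) (hS : ∀ x ∈ S, 0 ≤ x) :
    PointedMetricSpace.IsRadial ⟨S, ⟨0, h0⟩⟩ S := by
  have key : ∀ x : S, dist x (⟨0, h0⟩ : S) = x := fun x => by
    rw [Subtype.dist_eq, Real.dist_eq, sub_zero, abs_of_nonneg (hS x x.2)]
  refine ⟨fun x y => ?_, ?_⟩
  · change dist x y = |dist x (⟨0, h0⟩ : S) - dist y (⟨0, h0⟩ : S)|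
    rw [key, key, Subtype.dist_eq, Real.dist_eq]
  · change Set.range (fun x : S => dist x (⟨0, h0⟩ : S)) = S
    simp only [key, Subtype.range_coe_subtype, Set.ofPred_mem_eq]

theorem tendsto_dist_div {X : Type*} [MetricSpace X] {μ : Ultrafilter ℕ} {α : ℕ → ℝ}
    (hα : ∀ n, 0 < α n) {x y : ℕ → X} (h : scaledDist μ α x y ≠ ⊤) :
    Tendsto (fun n => dist (x n) (y n) / α n) (μ : Filter ℕ)
      (𝓝 (scaledDist μ α x y).toReal) := by
  have := (ENNReal.tendsto_toReal h).comp
    (tendsto_ulim μ fun n => ENNReal.ofReal (dist (x n) (y n) / α n))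
  refine this.congr fun n => ?_
  exact ENNReal.toReal_ofReal (div_nonneg dist_nonneg (hα n).le)

theorem scaledDist_eq_ofReal {X : Type*} [MetricSpace X] {μ : Ultrafilter ℕ} {α : ℕ → ℝ}
    {x y : ℕ → X} {a : ℝ}
    (h : Tendsto (fun n => dist (x n) (y n) / α n) (μ : Filter ℕ) (𝓝 a)) :
    scaledDist μ α x y = ENNReal.ofReal a :=
  ulim_eq (ENNReal.tendsto_ofReal h)

/-- The cone of a radial space modelled on `S` is radial, modelled on the set of limits of
sequences `x n / α n` with `x n ∈ S`. -/
theorem PointedMetricSpace.IsRadial.cone {P : PointedMetricSpace} {S T : Set ℝ}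
    (h : P.IsRadial S) {μ : Ultrafilter ℕ} {α : ℕ → ℝ} (hα : ∀ n, 0 < α n)
    (hST : ∀ y, y ∈ T ↔ ∃ x : ℕ → ℝ, (∀ n, x n ∈ S) ∧
      Tendsto (fun n => x n / α n) (μ : Filter ℕ) (𝓝 y)) :
    (P.cone μ α).IsRadial T := by
  have key : ∀ x : ConeSeq P.carrier μ (fun _ => P.point) α,
      Tendsto (fun n => dist (x.seq n) P.point / α n) (μ : Filter ℕ)
        (𝓝 (dist (SeparationQuotient.mk x : (P.cone μ α).carrier) (P.cone μ α).point)) :=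
    fun x => tendsto_dist_div hα x.finite.ne
  refine ⟨fun x y => ?_, Set.ext fun a => ⟨?_, fun ha => ?_⟩⟩
  · obtain ⟨x, rfl⟩ := SeparationQuotient.surjective_mk x
    obtain ⟨y, rfl⟩ := SeparationQuotient.surjective_mk y
    refine tendsto_nhds_unique (tendsto_dist_div hα (x.scaledDist_ne_top y)) ?_
    refine ((key x).sub (key y)).abs.congr fun n => ?_
    rw [h.1 (x.seq n) (y.seq n), ← sub_div, abs_div, abs_of_pos (hα n)]
  · rintro ⟨x, rfl⟩
    obtain ⟨x, rfl⟩ := SeparationQuotient.surjective_mk x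
    exact (hST _).2 ⟨fun n => dist (x.seq n) P.point, fun n => h.2 ▸ ⟨x.seq n, rfl⟩, key x⟩
  · obtain ⟨x, hx, hlim⟩ := (hST a).1 ha
    have : ∀ n, ∃ p : P.carrier, dist p P.point = x n := fun n => by
      have := hx n
      rw [← h.2] at this
      exact this
    choose p hp using this
    have hlim' : Tendsto (fun n => dist (p n) P.point / α n) (μ : Filter ℕ) (𝓝 a) := by
      simpa only [hp] using hlim
    let q : ConeSeq P.carrier μ (fun _ => P.point) α :=
      ⟨p, by rw [scaledDist_eq_ofReal hlim']; exact ENNReal.ofReal_lt_top⟩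
    exact ⟨SeparationQuotient.mk q, tendsto_nhds_unique (key q) hlim'⟩

theorem NonPrincipal.le_atTop {μ : Ultrafilter ℕ} (hμ : NonPrincipal μ) :
    (μ : Filter ℕ) ≤ atTop := by
  rw [← Nat.cofinite_eq_atTop]
  exact μ.le_cofinite_or_eq_pure.resolve_right fun ⟨n, hn⟩ => hμ n hn

/-! ### Construction of the models -/

/-- A bounded sequence with exactly `i % m + 1` cluster points. -/
noncomputable def node (m i n : ℕ) : ℝ := 1 + (n % (i % m + 1) : ℕ) + 1 / ((n : ℝ) + 1)

/-- An upper bound of `stage m n i`. -/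
noncomputable def radius (m n : ℕ) : ℝ := ((m : ℝ) + 2) ^ 3 ^ n

/-- The scaling factor. -/
noncomputable def scale (m n : ℕ) : ℝ := radius m n ^ 2

/-- Increasing finite sets, in which `stage m n (i + 1)` reappears at scale `scale m n`. -/
noncomputable def stage (m : ℕ) : ℕ → ℕ → Set ℝ
  | 0, _ => {0}
  | n + 1, i => insert (node m i n) (stage m n i ∪ (fun x => scale m n * x) '' stage m n (i + 1))

/-- The space that is homeomorphic to the `i`-th iterated cone. -/
noncomputable def model (m i : ℕ) : Set ℝ := closure (⋃ n, stage m n i)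

theorem two_le_radius (m n : ℕ) : 2 ≤ radius m n := by
  have h : (2 : ℝ) ≤ (m : ℝ) + 2 := by linarith [(Nat.cast_nonneg m : (0 : ℝ) ≤ m)]
  exact h.trans (le_self_pow₀ (by linarith) (by positivity))

theorem add_two_le_radius (m n : ℕ) : (m : ℝ) + 2 ≤ radius m n :=
  le_self_pow₀ (by linarith [(Nat.cast_nonneg m : (0 : ℝ) ≤ m)]) (by positivity)

/-- The exponents `3 ^ n` make the scaled copy of a stage fit under the next radius, while the
square in `scale` leaves a gap between `radius m n` and `scale m n`. -/
theorem radius_succ (m n : ℕ) : radius m (n + 1) = scale m n * radius m n := by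
  rw [scale, radius, radius, pow_succ 3 n, pow_mul]
  ring

theorem radius_mono (m : ℕ) : Monotone (radius m) := fun _ _ h =>
  pow_le_pow_right₀ (by linarith [(Nat.cast_nonneg m : (0 : ℝ) ≤ m)])
    (Nat.pow_le_pow_right (by norm_num) h)

theorem scale_mono (m : ℕ) : Monotone (scale m) := fun a b h =>
  pow_le_pow_left₀ (by linarith [two_le_radius m a]) (radius_mono m h) 2

theorem scale_pos (m n : ℕ) : 0 < scale m n :=
  pow_pos (by linarith [two_le_radius m n]) 2

theorem radius_le_scale (m n : ℕ) : radius m n ≤ scale m n :=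
  le_self_pow₀ (by linarith [two_le_radius m n]) two_ne_zero

theorem tendsto_radius (m : ℕ) : Tendsto (radius m) atTop atTop :=
  (tendsto_pow_atTop_atTop_of_one_lt
    (by linarith [(Nat.cast_nonneg m : (0 : ℝ) ≤ m)])).comp
    (tendsto_pow_atTop_atTop_of_one_lt (by norm_num))

theorem tendsto_scale (m : ℕ) : Tendsto (scale m) atTop atTop :=
  tendsto_atTop_mono (radius_le_scale m) (tendsto_radius m)

theorem isScalingFactor_scale (m : ℕ) : IsScalingFactor (scale m) :=
  ⟨scale_pos m, tendsto_scale m⟩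

theorem one_le_node (m i n : ℕ) : 1 ≤ node m i n := by
  unfold node
  have : (0 : ℝ) ≤ 1 / ((n : ℝ) + 1) := by positivity
  have : (0 : ℝ) ≤ (n % (i % m + 1) : ℕ) := Nat.cast_nonneg _
  linarith

theorem node_le {m : ℕ} (hm : 0 < m) (i n : ℕ) : node m i n ≤ (m : ℝ) + 2 := by
  unfold node
  have h1 : 1 / ((n : ℝ) + 1) ≤ 1 := by
    rw [div_le_one (by positivity)]
    linarith [(Nat.cast_nonneg n : (0 : ℝ) ≤ n)]
  have h2 : ((n % (i % m + 1) : ℕ) : ℝ) ≤ m := by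
    have := Nat.mod_lt n (Nat.add_one_pos (i % m))
    have := Nat.mod_lt i hm
    exact_mod_cast (by omega : n % (i % m + 1) ≤ m)
  linarith

theorem stage_succ (m n i : ℕ) : stage m (n + 1) i =
    insert (node m i n) (stage m n i ∪ (fun x => scale m n * x) '' stage m n (i + 1)) := rfl

theorem stage_mono (m i : ℕ) : Monotone fun n => stage m n i :=
  monotone_nat_of_le_succ fun _ _ hx => Set.mem_insert_of_mem _ (Or.inl hx)

theorem zero_mem_stage (m n i : ℕ) : (0 : ℝ) ∈ stage m n i :=
  stage_mono m i (Nat.zero_le n) (Set.mem_singleton 0)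

theorem finite_stage (m n i : ℕ) : (stage m n i).Finite := by
  induction n generalizing i with
  | zero => exact Set.finite_singleton 0
  | succ n ih => exact ((ih i).union ((ih (i + 1)).image _)).insert _

/-- Consequently the nonzero points of a copy scaled by `scale m n` lie beyond `scale m n`. -/
theorem stage_eq_zero_or_one_le {m n i : ℕ} {x : ℝ} (hx : x ∈ stage m n i) :
    x = 0 ∨ 1 ≤ x := by
  induction n generalizing i x with
  | zero => exact Or.inl hx
  | succ n ih =>
    obtain rfl | hx | ⟨z, hz, rfl⟩ := hx
    · exact Or.inr (one_le_node m i n)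
    · exact ih hx
    · rcases ih hz with rfl | hz
      · exact Or.inl (mul_zero _)
      · have := two_le_radius m n
        have := radius_le_scale m n
        exact Or.inr (one_le_mul_of_one_le_of_one_le (by linarith) hz)

theorem stage_le_radius {m : ℕ} (hm : 0 < m) {n i : ℕ} {x : ℝ} (hx : x ∈ stage m n i) :
    x ≤ radius m n := by
  induction n generalizing i x with
  | zero => rw [show x = 0 from hx]; linarith [two_le_radius m 0]
  | succ n ih =>
    obtain rfl | hx | ⟨z, hz, rfl⟩ := hx
    · exact (node_le hm i n).trans (add_two_le_radius m _)
    · exact (ih hx).trans (radius_mono m n.le_succ)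
    · rw [radius_succ]
      exact mul_le_mul_of_nonneg_left (ih hz) (scale_pos m n).le

/-- Nodes are below every radius. The copy inserted at step `N` lies below `radius m n` if `N < n`,
is the middle case if `N = n`, and is 0 or beyond `scale m (n + 1)` if `N > n`. -/
theorem stage_trichotomy {m : ℕ} (hm : 0 < m) {N i : ℕ} {x : ℝ} (hx : x ∈ stage m N i) (n : ℕ) :
    x ≤ radius m n ∨ x / scale m n ∈ stage m n (i + 1) ∨ scale m (n + 1) ≤ x := by
  have h2 := two_le_radius m n
  induction N with
  | zero => rw [show x = 0 from hx]; exact Or.inl (by linarith)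
  | succ N ih =>
    obtain rfl | hx | ⟨z, hz, rfl⟩ := hx
    · exact Or.inl ((node_le hm i N).trans (add_two_le_radius m _))
    · exact ih hx
    · dsimp only
      rcases lt_trichotomy N n with h | rfl | h
      · refine Or.inl (le_trans ?_ (radius_mono m h))
        rw [Nat.succ_eq_add_one, radius_succ]
        exact mul_le_mul_of_nonneg_left (stage_le_radius hm hz) (scale_pos m N).le
      · rw [mul_div_cancel_left₀ _ (scale_pos m N).ne']
        exact Or.inr (Or.inl hz)
      · rcases stage_eq_zero_or_one_le hz with rfl | hz
        · exact Or.inl (by linarith)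
        · exact Or.inr (Or.inr ((scale_mono m h).trans
            (le_mul_of_one_le_right (scale_pos m N).le hz)))

theorem stage_subset_model (m n i : ℕ) : stage m n i ⊆ model m i :=
  (Set.subset_iUnion (fun n => stage m n i) n).trans subset_closure

theorem isClosed_model (m i : ℕ) : IsClosed (model m i) := isClosed_closure

theorem zero_mem_model (m i : ℕ) : (0 : ℝ) ∈ model m i :=
  stage_subset_model m 0 i (zero_mem_stage m 0 i)

theorem model_nonneg {m i : ℕ} {x : ℝ} (hx : x ∈ model m i) : 0 ≤ x := by
  refine closure_minimal (t := Set.Ici 0) (Set.iUnion_subset fun _ x hx => ?_) isClosed_Ici hx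
  rcases stage_eq_zero_or_one_le hx with rfl | h
  · exact Set.self_mem_Ici
  · exact zero_le_one.trans h

theorem model_trichotomy {m : ℕ} (hm : 0 < m) {i : ℕ} {x : ℝ} (hx : x ∈ model m i) (n : ℕ) :
    x ≤ radius m n ∨ x / scale m n ∈ model m (i + 1) ∨ scale m (n + 1) ≤ x := by
  refine closure_minimal
    (t := {x | x ≤ radius m n ∨ x / scale m n ∈ model m (i + 1) ∨ scale m (n + 1) ≤ x})
    (Set.iUnion_subset fun N x hx => ?_) ?_ hx
  · exact (stage_trichotomy hm hx n).imp_right (Or.imp_left fun h => stage_subset_model _ _ _ h)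
  · exact isClosed_Iic.union
      (((isClosed_model m (i + 1)).preimage (continuous_id.div_const _)).union isClosed_Ici)

/-! ### The cone of each model is the next model -/

/-- After division by `scale m n`, the outer cases of the trichotomy give values at most `1 / radius
m n` or at least `radius m n`. Neither can tend to a positive finite limit. -/
theorem model_of_tendsto {m : ℕ} (hm : 0 < m) {i : ℕ} {μ : Ultrafilter ℕ}
    (hμ : (μ : Filter ℕ) ≤ atTop) {x : ℕ → ℝ} (hx : ∀ n, x n ∈ model m i) {y : ℝ}
    (hy : Tendsto (fun n => x n / scale m n) (μ : Filter ℕ) (𝓝 y)) : y ∈ model m (i + 1) := by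
  have hy0 : 0 ≤ y := ge_of_tendsto' hy fun n => div_nonneg (model_nonneg (hx n)) (scale_pos m n).le
  rcases hy0.eq_or_lt with rfl | hpos
  · exact zero_mem_model m _
  refine (isClosed_model m _).mem_of_tendsto hy ?_
  have hR := (tendsto_radius m).mono_left hμ
  filter_upwards [hy.eventually_const_lt (half_lt_self hpos),
    hy.eventually_lt_const (lt_add_one y), hR.eventually_ge_atTop (2 / y),
    hR.eventually_ge_atTop (y + 1)] with n h1 h2 h3 h4
  have hr := two_le_radius m n
  rw [lt_div_iff₀ (scale_pos m n)] at h1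
  rw [div_lt_iff₀ (scale_pos m n)] at h2
  rw [div_le_iff₀ hpos] at h3
  rcases model_trichotomy hm (hx n) n with h | h | h
  · rw [scale] at h1
    nlinarith
  · exact h
  · exfalso
    have h5 : radius m (n + 1) ≤ x n := (radius_le_scale m _).trans h
    rw [radius_succ] at h5
    have := mul_le_mul_of_nonneg_right h4 (scale_pos m n).le
    linarith

/-- Almost nearest points of `s n` to `y` work, since monotonicity makes the distances to `s n` tend
to 0. Convergence along `atTop` serves all non-principal ultrafilters at once. -/
theorem exists_tendsto_of_mem_closure_iUnion {s : ℕ → Set ℝ} (hs : Monotone s)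
    (h0 : ∀ n, (s n).Nonempty) {y : ℝ} (hy : y ∈ closure (⋃ n, s n)) :
    ∃ z : ℕ → ℝ, (∀ n, z n ∈ s n) ∧ Tendsto z atTop (𝓝 y) := by
  have : ∀ n : ℕ, ∃ z ∈ s n, dist y z < Metric.infDist y (s n) + 1 / ((n : ℝ) + 1) := fun n =>
    (Metric.infDist_lt_iff (h0 n)).1 (lt_add_of_pos_right _ (by positivity))
  choose z hz hd using this
  refine ⟨z, hz, Metric.tendsto_atTop.2 fun ε hε => ?_⟩
  obtain ⟨w, hw, hyw⟩ := Metric.mem_closure_iff.1 hy (ε / 2) (half_pos hε)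
  obtain ⟨k, hk⟩ := Set.mem_iUnion.1 hw
  obtain ⟨l, hl⟩ := exists_nat_one_div_lt (half_pos hε)
  refine ⟨max k l, fun n hn => ?_⟩
  have h1 : Metric.infDist y (s n) ≤ dist y w :=
    Metric.infDist_le_dist_of_mem (hs ((le_max_left k l).trans hn) hk)
  have h2 : 1 / ((n : ℝ) + 1) ≤ 1 / ((l : ℝ) + 1) :=
    Nat.one_div_le_one_div ((le_max_right k l).trans hn)
  rw [dist_comm]
  linarith [hd n]

theorem exists_tendsto_of_mem_model {m i : ℕ} {y : ℝ} (hy : y ∈ model m (i + 1)) :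
    ∃ x : ℕ → ℝ, (∀ n, x n ∈ model m i) ∧ Tendsto (fun n => x n / scale m n) atTop (𝓝 y) := by
  obtain ⟨z, hz, hlim⟩ := exists_tendsto_of_mem_closure_iUnion (stage_mono m (i + 1))
    (fun n => ⟨0, zero_mem_stage m n _⟩) hy
  refine ⟨fun n => scale m n * z n, fun n => stage_subset_model m (n + 1) i
    (Set.mem_insert_of_mem _ (Or.inr ⟨z n, hz n, rfl⟩)), hlim.congr fun n => ?_⟩
  rw [mul_div_cancel_left₀ _ (scale_pos m n).ne']

theorem isRadial_iterCone {m : ℕ} (hm : 0 < m) {μ : Ultrafilter ℕ} (hμ : NonPrincipal μ) (i : ℕ) :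
    (iterCone ⟨model m 0, ⟨0, zero_mem_model m 0⟩⟩ μ (scale m) i).IsRadial (model m i) := by
  induction i with
  | zero => exact isRadial_subtype (zero_mem_model m 0) fun _ => model_nonneg
  | succ i ih =>
    refine ih.cone (scale_pos m) fun y => ⟨fun hy => ?_, ?_⟩
    · obtain ⟨x, hx, hlim⟩ := exists_tendsto_of_mem_model hy
      exact ⟨x, hx, hlim.mono_left hμ.le_atTop⟩
    · rintro ⟨x, hx, hlim⟩
      exact model_of_tendsto hm hμ.le_atTop hx hlim

/-! ### Periodicity and accumulation points -/

theorem stage_congr {m i j : ℕ} (h : i ≡ j [MOD m]) (n : ℕ) : stage m n i = stage m n j := by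
  induction n generalizing i j with
  | zero => rfl
  | succ n ih =>
    rw [stage_succ, stage_succ, ih h, ih (h.add_right 1), node, node, show i % m = j % m from h]

theorem model_congr {m i j : ℕ} (h : i ≡ j [MOD m]) : model m i = model m j := by
  simp only [model, stage_congr h]

theorem node_mem_stage (m i n : ℕ) : node m i n ∈ stage m (n + 1) i := Set.mem_insert _ _

/-- Copies inserted from step `N` on have no nonzero point below `M`, so only nodes can be new
there. -/
theorem stage_subset_of_lt {m N i : ℕ} {M : ℝ} (hM : M ≤ scale m N) (n : ℕ) :
    stage m n i ∩ Set.Iio M ⊆ stage m N i ∪ Set.range (node m i) := by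
  induction n with
  | zero => rintro _ ⟨rfl, -⟩; exact Or.inl (zero_mem_stage m N i)
  | succ n ih =>
    rintro x ⟨hx, hxM⟩
    rcases le_total (n + 1) N with h | h
    · exact Or.inl (stage_mono m i h hx)
    rcases hx with rfl | hx | ⟨z, hz, rfl⟩
    · exact Or.inr ⟨n, rfl⟩
    · exact ih ⟨hx, hxM⟩
    · rcases stage_eq_zero_or_one_le hz with rfl | hz1
      · left; dsimp only; rw [mul_zero]; exact zero_mem_stage m N i
      · rcases h.eq_or_lt with rfl | h
        · exact Or.inl (Set.mem_insert_of_mem _ (Or.inr ⟨z, hz, rfl⟩))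
        · have h1 := scale_mono m (Nat.lt_succ_iff.1 h)
          have h2 := le_mul_of_one_le_right (scale_pos m n).le hz1
          exact absurd hxM (not_lt.2 (hM.trans (h1.trans h2)))

theorem mem_of_accPt_range_node {m i : ℕ} {x : ℝ} (h : AccPt x (𝓟 (Set.range (node m i)))) :
    x ∈ (fun r : ℕ => 1 + (r : ℝ)) '' Set.Iio (i % m + 1) := by
  set K : Set ℝ := (fun r : ℕ => 1 + (r : ℝ)) '' Set.Iio (i % m + 1) with hK
  have hne : K.Nonempty := ⟨_, Set.mem_image_of_mem _ (Nat.succ_pos (i % m))⟩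
  have hcl : IsClosed K := ((Set.finite_Iio _).image _).isClosed
  by_contra hx
  have hδ : 0 < Metric.infDist x K := (hcl.notMem_iff_infDist_pos hne).1 hx
  obtain ⟨l, hl⟩ := exists_nat_one_div_lt (half_pos hδ)
  -- Only nodes of index below `l` can be this close to `x`: the later ones are within half of
  -- `infDist x K` of `K`.
  refine (Set.Infinite.of_accPt (h.nhds_inter (Metric.ball_mem_nhds x (half_pos hδ))))
    (((Set.finite_Iio l).image (node m i)).subset ?_)
  rintro _ ⟨hb, n, rfl⟩
  refine ⟨n, ?_, rfl⟩
  by_contra hn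
  have h1 : 1 / ((n : ℝ) + 1) ≤ 1 / ((l : ℝ) + 1) := Nat.one_div_le_one_div (not_lt.1 hn)
  have hr : 1 + ((n % (i % m + 1) : ℕ) : ℝ) ∈ K :=
    ⟨_, Nat.mod_lt n (Nat.succ_pos (i % m)), rfl⟩
  have h2 := Metric.infDist_le_dist_of_mem (x := x) hr
  have h3 := dist_triangle_left x (1 + ((n % (i % m + 1) : ℕ) : ℝ)) (node m i n)
  have h4 : dist (node m i n) (1 + ((n % (i % m + 1) : ℕ) : ℝ)) = 1 / ((n : ℝ) + 1) := by
    rw [Real.dist_eq, node, add_sub_cancel_left, abs_of_nonneg (by positivity)]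
  rw [Metric.mem_ball] at hb
  linarith

theorem accPt_range_node {m i r : ℕ} (hr : r < i % m + 1) :
    AccPt (1 + (r : ℝ)) (𝓟 (Set.range (node m i))) := by
  refine accPt_iff_nhds.2 fun U hU => ?_
  obtain ⟨ε, hε, hU⟩ := Metric.mem_nhds_iff.1 hU
  obtain ⟨t, ht⟩ := exists_nat_one_div_lt hε
  -- An index in the residue class of `r`, large enough for the term `1 / (n + 1)` to be below `ε`.
  set n := r + (i % m + 1) * t with hn
  have htn : t ≤ n := (Nat.le_mul_of_pos_left t (Nat.succ_pos (i % m))).trans (Nat.le_add_left _ _)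
  have h1 : 1 / ((n : ℝ) + 1) ≤ 1 / ((t : ℝ) + 1) := Nat.one_div_le_one_div htn
  have h0 : 0 < 1 / ((n : ℝ) + 1) := by positivity
  have hnode : node m i n = 1 + (r : ℝ) + 1 / ((n : ℝ) + 1) := by
    rw [node, show n % (i % m + 1) = r by rw [hn, Nat.add_mul_mod_self_left, Nat.mod_eq_of_lt hr]]
  refine ⟨node m i n, ⟨hU ?_, n, rfl⟩, ?_⟩
  · rw [hnode, Metric.mem_ball, Real.dist_eq, add_sub_cancel_left, abs_of_pos h0]
    linarith
  · rw [hnode]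
    linarith

theorem derivedSet_model (m i : ℕ) :
    derivedSet (model m i) = (fun r : ℕ => 1 + (r : ℝ)) '' Set.Iio (i % m + 1) := by
  rw [model, derivedSet_closure]
  ext x
  constructor
  · intro hx
    obtain ⟨N, hN⟩ := ((tendsto_scale m).eventually_ge_atTop (x + 1)).exists
    have hsub : Set.Iio (x + 1) ∩ (⋃ n, stage m n i) ⊆ stage m N i ∪ Set.range (node m i) := by
      rintro y ⟨hy, hyU⟩
      obtain ⟨n, hn⟩ := Set.mem_iUnion.1 hyU
      exact stage_subset_of_lt hN n ⟨hn, hy⟩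
    have h := ((mem_derivedSet.1 hx).nhds_inter (Iio_mem_nhds (lt_add_one x))).mono
      (principal_mono.2 hsub)
    rw [← sup_principal, accPt_sup] at h
    exact mem_of_accPt_range_node
      (h.resolve_left fun h' => Set.Infinite.of_accPt h' (finite_stage m N i))
  · rintro ⟨r, hr, rfl⟩
    refine (accPt_range_node hr).mono (principal_mono.2 ?_)
    rintro _ ⟨n, rfl⟩
    exact Set.mem_iUnion.2 ⟨n + 1, node_mem_stage m i n⟩

/-! ### Counting non-isolated points -/

/-- Covers both uses: a homeomorphism, whose range is everything, and the inclusion of a closed set,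
which contains its derived set. -/
theorem image_derivedSet_univ {X Y : Type*} [TopologicalSpace X] [TopologicalSpace Y]
    {f : X → Y} (hf : IsEmbedding f) :
    f '' derivedSet Set.univ = derivedSet (Set.range f) ∩ Set.range f := by
  have key : ∀ x, x ∈ derivedSet (Set.univ : Set X) ↔ f x ∈ derivedSet (Set.range f) := by
    intro x
    simp only [mem_derivedSet, accPt_iff_nhds, hf.nhds_eq_comap]
    constructor
    · intro h U hU
      obtain ⟨y, ⟨hy, -⟩, hne⟩ := h _ (preimage_mem_comap hU)
      exact ⟨f y, ⟨hy, y, rfl⟩, hf.injective.ne hne⟩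
    · rintro h U ⟨V, hV, hVU⟩
      obtain ⟨_, ⟨hy, y, rfl⟩, hne⟩ := h V hV
      exact ⟨y, ⟨hVU hy, trivial⟩, fun h => hne (h ▸ rfl)⟩
  ext y
  constructor
  · rintro ⟨x, hx, rfl⟩
    exact ⟨(key x).1 hx, x, rfl⟩
  · rintro ⟨hy, x, rfl⟩
    exact ⟨x, (key x).2 hy, rfl⟩

theorem ncard_derivedSet_univ_eq {X Y : Type*} [TopologicalSpace X] [TopologicalSpace Y]
    (f : X ≃ₜ Y) :
    (derivedSet (Set.univ : Set X)).ncard = (derivedSet (Set.univ : Set Y)).ncard := by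
  rw [← Set.ncard_image_of_injective _ f.injective, image_derivedSet_univ f.isEmbedding,
    f.surjective.range_eq, Set.inter_univ]

theorem ncard_derivedSet_univ_model (m i : ℕ) :
    (derivedSet (Set.univ : Set (model m i))).ncard = i % m + 1 := by
  rw [← Set.ncard_image_of_injective _ Subtype.val_injective,
    image_derivedSet_univ IsEmbedding.subtypeVal, Subtype.range_coe,
    Set.inter_eq_left.2 ((isClosed_iff_derivedSet_subset _).1 (isClosed_model m i)),
    derivedSet_model, Set.ncard_image_of_injective _
      fun a b h => Nat.cast_injective (add_left_cancel h),
    ← Finset.coe_Iio, Set.ncard_coe_finset, Nat.card_Iio]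

end IterCone

theorem mainTheorem4 (m : ℕ) (hm : 0 < m) :
    ∃ (X : Type) (_ : MetricSpace X) (e : X) (α : ℕ → ℝ), IterCone.IsScalingFactor α ∧
      ∀ μ : Ultrafilter ℕ, IterCone.NonPrincipal μ → ∀ i j : ℕ,
        Nonempty ((IterCone.iterCone ⟨X, e⟩ μ α i).carrier ≃ₜ
          (IterCone.iterCone ⟨X, e⟩ μ α j).carrier) ↔ i ≡ j [MOD m] := by
  refine ⟨IterCone.model m 0, inferInstance, ⟨0, IterCone.zero_mem_model m 0⟩, IterCone.scale m,
    IterCone.isScalingFactor_scale m, fun μ hμ i j => ?_⟩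
  obtain ⟨f⟩ := (IterCone.isRadial_iterCone hm hμ i).nonempty_homeomorph
  obtain ⟨g⟩ := (IterCone.isRadial_iterCone hm hμ j).nonempty_homeomorph
  constructor
  · rintro ⟨φ⟩
    have := IterCone.ncard_derivedSet_univ_eq ((f.symm.trans φ).trans g)
    rw [IterCone.ncard_derivedSet_univ_model, IterCone.ncard_derivedSet_univ_model] at this
    exact Nat.succ_injective this
  · intro h
    exact ⟨(f.trans (Homeomorph.setCongr (IterCone.model_congr h))).trans g.symm⟩
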